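/- A simple game on $N=\{1,\dots,n\}$ is a collection $\mathcal W$ of subsets of $N$ (the winning coalitions; the other subsets are losing) with $\emptyset\notin\mathcal W$, $N\in\mathcal W$, and $T\in\mathcal W$ whenever $S\in\mathcal W$ and $S\subseteq T\subseteq N$. It is weighted if there are real weights $w_1,\dots,w_n\ge 0$ and a real quota $q>0$ such that $S\in\mathcal W$ if and only if $\sum_{i\in S}w_i\ge q$. Two games are isomorphic if a bijection of the players maps the winning coalitions of one exactly onto those of the other. Player $i$ is at least as desirable as player $j$ if the transposition of $i$ and $j$ maps every winning coalition containing $j$ to a winning coalition; in a weighted game this is a total preorder, so it partitions $N$ into classes of equally desirable players $N_1>N_2>\dots>N_t$, listed by strictly decreasing desirability. A vector is a tuple $m=(m_1,\dots,m_t)$ of integers with $0\le m_h\le |N_h|$; it is winning (losing) if the coalitions $S$ with $|S\cap N_h|=m_h$ for all $h$ are winning (losing). Write $a\succeq b$ if $\sum_{i\le k}a_i\ge\sum_{i\le k}b_i$ for all $1\le k\le t$. A vector $m$ is shift-minimal winning if it is winning and every vector $m'\ne m$ with $m\succeq m'$ is losing. Let $wg(n,\ast,1)$ denote the number of weighted games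 with $n$ players, up to isomorphism, that have exactly one shift-minimal winning vector (with any number $t$ of classes). Then $$wg(n,\ast,1)=\begin{cases}2^n-1 & \text{if } n\le 5,\\[4pt] \dfrac{n^4-6n^3+23n^2-18n+12}{12} & \text{if } n\ge 6.\end{cases}$$ -/

import Mathlib

/-- A (monotonic) simple game on the player set `Fin n`. -/
@[ext]
structure SimpleGame (n : ℕ) where
  /-- the winning coalitions -/
  winning : Set (Finset (Fin n))
  empty_notMem : ∅ ∉ winning
  univ_mem : Finset.univ ∈ winning
  mono : ∀ S T : Finset (Fin n), S ∈ winning → S ⊆ T → T ∈ winning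

namespace SimpleGame

variable {n : ℕ}

/-- `G` admits a representation by non-negative real weights and a positive real quota. -/
def IsWeighted (G : SimpleGame n) : Prop :=
  ∃ (q : ℝ) (w : Fin n → ℝ), 0 < q ∧ (∀ i, 0 ≤ w i) ∧
    ∀ S : Finset (Fin n), S ∈ G.winning ↔ q ≤ ∑ i ∈ S, w i

/-- Two simple games are isomorphic if some bijection of the players carries the winning
coalitions of the first exactly to those of the second. -/
def Isomorphic (G H : SimpleGame n) : Prop :=
  ∃ f : Fin n ≃ Fin n, ∀ S : Finset (Fin n), S ∈ G.winning ↔ S.map f.toEmbedding ∈ H.winning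

/-- Isomorphism as an equivalence relation on the simple games with `n` players. -/
def isoSetoid (n : ℕ) : Setoid (SimpleGame n) where
  r := Isomorphic
  iseqv :=
    { refl := fun G => ⟨Equiv.refl _, fun S => by simp⟩
      symm := by
        rintro G H ⟨f, hf⟩
        refine ⟨f.symm, fun S => ?_⟩
        rw [hf, Finset.map_map]
        simp
      trans := by
        rintro G H K ⟨f, hf⟩ ⟨g, hg⟩
        refine ⟨f.trans g, fun S => ?_⟩
        rw [hf, hg, Finset.map_map]
        rfl }

/-- The winning coalitions that contain player `i`. -/
def winningWith (G : SimpleGame n) (i : Fin n) : Set (Finset (Fin n)) :=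
  {S | S ∈ G.winning ∧ i ∈ S}

/-- The desirability relation: `i` is at least as desirable as `j` if the transposition of `i`
and `j` maps every winning coalition containing `j` to a winning coalition containing `i`. -/
def Desirable (G : SimpleGame n) (i j : Fin n) : Prop :=
  (fun S : Finset (Fin n) => S.map (Equiv.swap i j).toEmbedding) '' G.winningWith j
    ⊆ G.winningWith i

/-- A game is complete if any two players are comparable in the desirability relation. -/
def IsComplete (G : SimpleGame n) : Prop :=
  ∀ i j : Fin n, G.Desirable i j ∨ G.Desirable j i

theorem desirable_iff (G : SimpleGame n) (i j : Fin n) :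
    G.Desirable i j ↔
      ∀ S ∈ G.winning, j ∈ S → S.map (Equiv.swap i j).toEmbedding ∈ G.winning := by
  constructor
  · intro h S hS hj
    exact (h ⟨S, ⟨hS, hj⟩, rfl⟩).1
  · rintro h _ ⟨S, ⟨hS, hj⟩, rfl⟩
    exact ⟨h S hS hj, Finset.mem_map.2 ⟨j, hj, by simp⟩⟩

/-- Weighted games are complete, so that their classes are linearly ordered. -/
theorem IsWeighted.isComplete {G : SimpleGame n} (hG : G.IsWeighted) : G.IsComplete := by
  obtain ⟨q, w, -, -, hw⟩ := hG
  have main : ∀ i j : Fin n, w j ≤ w i → G.Desirable i j := by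
    intro i j hij
    rw [desirable_iff]
    intro S hS hj
    by_cases hi : i ∈ S
    · refine G.mono S _ hS fun x hx => ?_
      refine Finset.mem_map.2 ⟨Equiv.swap i j x, ?_, by simp⟩
      rw [Equiv.swap_apply_def]
      split_ifs <;> assumption
    · rw [hw] at hS ⊢
      rw [Finset.sum_map]
      refine hS.trans (Finset.sum_le_sum fun x hx => ?_)
      have hxi : x ≠ i := fun h => hi (h ▸ hx)
      by_cases hxj : x = j
      · subst hxj; simpa using hij
      · simp [Equiv.swap_apply_of_ne_of_ne hxi hxj]
  intro i j
  rcases le_total (w j) (w i) with h | h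
  · exact Or.inl (main i j h)
  · exact Or.inr (main j i h)

theorem desirable_refl (G : SimpleGame n) (i : Fin n) : G.Desirable i i := by
  rw [desirable_iff]
  intro S hS _
  simpa using hS

theorem desirable_trans (G : SimpleGame n) {i j k : Fin n}
    (hij : G.Desirable i j) (hjk : G.Desirable j k) : G.Desirable i k := by
  by_cases eij : i = j
  · subst eij; exact hjk
  by_cases ejk : j = k
  · subst ejk; exact hij
  by_cases eik : i = k
  · subst eik; exact G.desirable_refl i
  rw [desirable_iff] at *
  intro S hS hk
  have key : ∀ (a b x : Fin n) (T : Finset (Fin n)),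
      x ∈ T.map (Equiv.swap a b).toEmbedding ↔ Equiv.swap a b x ∈ T := by
    intro a b x T
    simp only [Finset.mem_map, Equiv.coe_toEmbedding]
    constructor
    · rintro ⟨y, hy, rfl⟩; simpa using hy
    · intro h; exact ⟨_, h, by simp⟩
  by_cases hj : j ∈ S
  · have h1 := hij S hS hj
    by_cases hi : i ∈ S
    · refine G.mono S _ hS ?_
      intro x hx
      rw [key, Equiv.swap_apply_def]
      split_ifs <;> assumption
    · have h2 := hjk _ h1 (by
        rw [key, Equiv.swap_apply_of_ne_of_ne (Ne.symm eik) (Ne.symm ejk)]; exact hk)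
      refine G.mono _ _ h2 ?_
      intro x hx
      rw [key, key] at hx
      rw [key]
      simp only [Equiv.swap_apply_def] at hx ⊢
      grind
  · by_cases hi : i ∈ S
    · refine G.mono S _ hS ?_
      intro x hx
      rw [key, Equiv.swap_apply_def]
      split_ifs <;> assumption
    · have h1 := hjk S hS hk
      have h2 := hij _ h1 (by rw [key]; simpa using hk)
      refine G.mono _ _ h2 ?_
      intro x hx
      rw [key, key] at hx
      rw [key]
      simp only [Equiv.swap_apply_def] at hx ⊢
      grind

/-- Equi-desirability of players. -/
def classSetoid (G : SimpleGame n) : Setoid (Fin n) where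
  r i j := G.Desirable i j ∧ G.Desirable j i
  iseqv :=
    { refl := fun i => ⟨G.desirable_refl i, G.desirable_refl i⟩
      symm := fun h => ⟨h.2, h.1⟩
      trans := fun h h' => ⟨G.desirable_trans h.1 h'.1, G.desirable_trans h'.2 h.2⟩ }

/-- The set of classes of equi-desirable players. -/
def PlayerClass (G : SimpleGame n) : Type := Quotient G.classSetoid

/-- The class of a player. -/
def classOf (G : SimpleGame n) (i : Fin n) : G.PlayerClass := Quotient.mk G.classSetoid i

instance (G : SimpleGame n) : Finite G.PlayerClass :=
  inferInstanceAs (Finite (Quotient G.classSetoid))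

noncomputable instance (G : SimpleGame n) : Fintype G.PlayerClass := Fintype.ofFinite _

/-- The order on the classes induced by desirability: `p` is at least as strong as `q`. -/
def ClassGE (G : SimpleGame n) (p q : G.PlayerClass) : Prop :=
  ∀ i j : Fin n, G.classOf i = p → G.classOf j = q → G.Desirable i j

open Classical in
/-- The type of a coalition: the number of its members in each class. -/
noncomputable def coalitionType (G : SimpleGame n) (S : Finset (Fin n)) : G.PlayerClass → ℕ :=
  fun p => (S.filter fun i => G.classOf i = p).card

/-- `m` is a coalition vector of `G`: in each class it has at most as many players as there are.
Vectors are indexed by the classes themselves; for a complete game the classes are linearly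
ordered by `ClassGE`, so this is the same as indexing by `1, …, t` in decreasing order. -/
def IsVector (G : SimpleGame n) (m : G.PlayerClass → ℕ) : Prop :=
  ∀ p, m p ≤ G.coalitionType Finset.univ p

/-- All coalitions of type `m` are winning. -/
def IsWinningVector (G : SimpleGame n) (m : G.PlayerClass → ℕ) : Prop :=
  G.IsVector m ∧ ∀ S : Finset (Fin n), G.coalitionType S = m → S ∈ G.winning

/-- All coalitions of type `m` are losing. -/
def IsLosingVector (G : SimpleGame n) (m : G.PlayerClass → ℕ) : Prop :=
  G.IsVector m ∧ ∀ S : Finset (Fin n), G.coalitionType S = m → S ∉ G.winning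

open Classical in
/-- The sum of the entries of `a` over the class `p` and all stronger classes. -/
noncomputable def partialSum (G : SimpleGame n) (a : G.PlayerClass → ℕ) (p : G.PlayerClass) : ℕ :=
  ∑ q with G.ClassGE q p, a q

/-- The shift order on vectors: all partial sums of `a`, starting from the strongest class, are
at least those of `b`. -/
def ShiftGE (G : SimpleGame n) (a b : G.PlayerClass → ℕ) : Prop :=
  ∀ p, G.partialSum b p ≤ G.partialSum a p

/-- `m` is winning and every vector strictly below `m` in the shift order is losing. -/
def IsShiftMinimalWinningVector (G : SimpleGame n) (m : G.PlayerClass → ℕ) : Prop :=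
  G.IsWinningVector m ∧
    ∀ m' : G.PlayerClass → ℕ, G.IsVector m' → G.ShiftGE m m' → m ≠ m' → G.IsLosingVector m'

/-- The number of weighted games with `n` players and exactly `r` shift-minimal winning vectors,
up to isomorphism. -/
noncomputable def numWeighted (n r : ℕ) : ℕ :=
  (Quotient.mk (isoSetoid n) ''
    {G : SimpleGame n | G.IsWeighted ∧ {m | G.IsShiftMinimalWinningVector m}.ncard = r}).ncard

end SimpleGame

/-! Number the players by decreasing desirability. A complete game has exactly one shift-minimal
winning vector iff some coalition `M` exists such that the winning coalitions are those dominating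
`M`. Choosing `M` as far to the right as its classes allow, domination becomes a comparison of all
prefix counts, and `M` is then determined by the game. Hence isomorphism classes correspond to
non-empty `M`, that is, to 0-1 words other than `0^n` (`IsSorted.exists_eq_shiftGame`,
`eq_of_isIso_of_isSorted`, `numWeighted_one`).

Such a game is weighted iff its word avoids the subsequences `010011` and `010101`. Either of them
allows two winning coalitions to be traded for two losing ones (`not_isWeighted_shiftGame`). A word
avoiding both has the form `1^x 0^a 1^b 0^c 1^d 0^y` with `c = 1` or `d ≤ 1`, and explicit weights
exist (`isWeighted_shiftGame`).

A chain of predicates reading the word letter by letter recognises these words and yields recursions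
for their number. Removing `0^n` gives the polynomial for every `n ≥ 1`. It agrees with `2^n - 1`
for `1 ≤ n ≤ 5`, as the forbidden patterns have length six. -/

namespace SimpleGame

variable {n : ℕ}

/-! ### The shift order, on coalitions and on vectors -/

open Classical in
/-- The number of members of `S` that are at least as desirable as `p`. -/
noncomputable def upCount (G : SimpleGame n) (S : Finset (Fin n)) (p : Fin n) : ℕ :=
  (S.filter fun i => G.Desirable i p).card

/-- Coalition `S` dominates `T` in the shift order. -/
def Dominates (G : SimpleGame n) (S T : Finset (Fin n)) : Prop :=
  ∀ p, G.upCount T p ≤ G.upCount S p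

theorem mem_map_swap {i j x : Fin n} {S : Finset (Fin n)} :
    x ∈ S.map (Equiv.swap i j).toEmbedding ↔ Equiv.swap i j x ∈ S := by
  simp only [Finset.mem_map, Equiv.coe_toEmbedding]
  constructor
  · rintro ⟨y, hy, rfl⟩; simpa using hy
  · intro h; exact ⟨_, h, by simp⟩

theorem map_swap_eq {i j : Fin n} {S : Finset (Fin n)} (hi : i ∉ S) (hj : j ∈ S) :
    S.map (Equiv.swap i j).toEmbedding = insert i (S.erase j) := by
  ext x
  rw [mem_map_swap, Equiv.swap_apply_def]
  grind

theorem Desirable.insert_erase_mem {G : SimpleGame n} {i j : Fin n} (h : G.Desirable i j)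
    {S : Finset (Fin n)} (hS : S ∈ G.winning) (hi : i ∉ S) (hj : j ∈ S) :
    insert i (S.erase j) ∈ G.winning := by
  rw [← map_swap_eq hi hj]
  exact (G.desirable_iff i j).1 h S hS hj

theorem desirable_of_insert_erase {G : SimpleGame n} {i j : Fin n}
    (h : ∀ S ∈ G.winning, i ∉ S → j ∈ S → insert i (S.erase j) ∈ G.winning) :
    G.Desirable i j := by
  rw [desirable_iff]
  intro S hS hj
  by_cases hi : i ∈ S
  · refine G.mono S _ hS fun x hx => ?_
    rw [mem_map_swap, Equiv.swap_apply_def]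
    split_ifs <;> assumption
  · rw [map_swap_eq hi hj]
    exact h S hS hi hj

/-- Exchange argument: the most desirable `i` in `T \ S` is replaced in `T` by some `j` in `S \ T`
at least as desirable. This keeps `T` winning and dominated by `S`, and shrinks `T \ S`. -/
theorem Dominates.winning {G : SimpleGame n} (hG : G.IsComplete) {S T : Finset (Fin n)}
    (h : G.Dominates S T) (hT : T ∈ G.winning) : S ∈ G.winning := by
  classical
  induction hk : (T \ S).card using Nat.strong_induction_on generalizing T with
  | _ k ih =>
  rcases (T \ S).eq_empty_or_nonempty with he | hne
  · exact G.mono T S hT (Finset.sdiff_eq_empty_iff_subset.1 he)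
  -- a most desirable member of `T \ S`
  obtain ⟨i, hi, hmin⟩ := Finset.exists_min_image (T \ S) (G.upCount Finset.univ) hne
  have hstrong : ∀ x ∈ T \ S, G.Desirable i x := by
    intro x hx
    rcases hG i x with h1 | h1
    · exact h1
    by_contra h2
    refine absurd (hmin x hx) (not_le.2 (Finset.card_lt_card ?_))
    refine Finset.ssubset_iff_of_subset (fun y hy => ?_) |>.2 ⟨i, ?_, ?_⟩
    · simp only [Finset.mem_filter, Finset.mem_univ, true_and] at hy ⊢
      exact G.desirable_trans hy h1
    · simpa using G.desirable_refl i
    · simpa using h2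
  rw [Finset.mem_sdiff] at hi
  -- Otherwise `T` would have strictly more members than `S` at or above the level of `i`, namely
  -- all those of `S` and `i` itself.
  obtain ⟨j, hj, hjT⟩ : ∃ j ∈ S.filter (fun x => G.Desirable x i), j ∉ T := by
    by_contra! hcon
    have hsub : S.filter (fun x => G.Desirable x i) ⊂ T.filter (fun x => G.Desirable x i) := by
      refine Finset.ssubset_iff_of_subset (fun y hy => ?_) |>.2 ⟨i, ?_, ?_⟩
      · exact Finset.mem_filter.2 ⟨hcon y hy, (Finset.mem_filter.1 hy).2⟩
      · simpa [hi.1] using G.desirable_refl i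
      · simp [hi.2]
    exact absurd (h i) (not_le.2 (Finset.card_lt_card hsub))
  obtain ⟨hjS, hji⟩ := Finset.mem_filter.1 hj
  have hij : i ≠ j := fun e => hi.2 (e ▸ hjS)
  refine ih _ ?_ (fun p => ?_) (hji.insert_erase_mem hT hjT hi.1) rfl
  · rw [← hk]
    refine Finset.card_lt_card (Finset.ssubset_iff_of_subset ?_ |>.2 ⟨i, ?_, ?_⟩)
    · intro x; grind
    · grind
    · grind
  · by_cases hip : G.Desirable i p
    · refine le_trans ?_ (h p)
      have hjp := G.desirable_trans hji hip
      unfold upCount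
      have : (insert j (T.erase i)).filter (fun x => G.Desirable x p)
          = insert j ((T.filter (fun x => G.Desirable x p)).erase i) := by
        ext x; grind
      rw [this]
      refine (Finset.card_insert_le _ _).trans ?_
      rw [Finset.card_erase_add_one]
      simp [hi.1, hip]
    -- Above the level of `i` nothing of `T` lies outside `S`, by the choice of `i`.
    · refine Finset.card_le_card fun x hx => ?_
      simp only [Finset.mem_filter, Finset.mem_insert, Finset.mem_erase] at hx ⊢
      refine ⟨?_, hx.2⟩
      rcases hx.1 with rfl | ⟨_, hxT⟩
      · exact hjS
      · by_contra hxS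
        exact hip (G.desirable_trans (hstrong x (Finset.mem_sdiff.2 ⟨hxT, hxS⟩)) hx.2)

theorem classGE_classOf (G : SimpleGame n) (i j : Fin n) :
    G.ClassGE (G.classOf i) (G.classOf j) ↔ G.Desirable i j := by
  constructor
  · intro h; exact h i j rfl rfl
  · intro h a b ha hb
    have ha' : G.classSetoid.r a i := Quotient.exact ha
    have hb' : G.classSetoid.r b j := Quotient.exact hb
    exact G.desirable_trans ha'.1 (G.desirable_trans h hb'.2)

theorem exists_classOf_eq (G : SimpleGame n) (p : G.PlayerClass) : ∃ i, G.classOf i = p :=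
  Quotient.exists_rep p

theorem partialSum_coalitionType (G : SimpleGame n) (S : Finset (Fin n)) (j : Fin n) :
    G.partialSum (G.coalitionType S) (G.classOf j) = G.upCount S j := by
  classical
  unfold partialSum upCount coalitionType
  rw [Finset.card_eq_sum_card_fiberwise (f := G.classOf)
    (t := Finset.univ.filter fun q => G.ClassGE q (G.classOf j))]
  · refine Finset.sum_congr rfl fun q hq => ?_
    congr 1
    ext i
    simp only [Finset.mem_filter, Finset.mem_univ, true_and] at hq ⊢
    constructor
    · rintro ⟨h1, rfl⟩
      exact ⟨⟨h1, (G.classGE_classOf i j).1 hq⟩, rfl⟩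
    · rintro ⟨⟨h1, _⟩, h2⟩
      exact ⟨h1, h2⟩
  · intro i hi
    simp only [Finset.coe_filter, Set.mem_ofPred_eq, Finset.mem_univ, true_and] at hi ⊢
    exact (G.classGE_classOf i j).2 hi.2

theorem shiftGE_coalitionType (G : SimpleGame n) (S T : Finset (Fin n)) :
    G.ShiftGE (G.coalitionType S) (G.coalitionType T) ↔ G.Dominates S T := by
  constructor
  · intro h p
    simpa only [partialSum_coalitionType] using h (G.classOf p)
  · intro h p
    obtain ⟨i, rfl⟩ := G.exists_classOf_eq p
    simpa only [partialSum_coalitionType] using h i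

theorem isVector_coalitionType (G : SimpleGame n) (S : Finset (Fin n)) :
    G.IsVector (G.coalitionType S) := by
  intro p
  unfold coalitionType
  gcongr
  exact Finset.subset_univ S

theorem IsVector.exists_coalitionType_eq {G : SimpleGame n} {m : G.PlayerClass → ℕ}
    (h : G.IsVector m) : ∃ S, G.coalitionType S = m := by
  classical
  choose T hT hc using fun p => Finset.exists_subset_card_eq (h p)
  refine ⟨Finset.univ.filter fun i => i ∈ T (G.classOf i), funext fun p => ?_⟩
  rw [← hc p]
  unfold coalitionType
  congr 1
  ext i
  simp only [Finset.mem_filter, Finset.mem_univ, true_and]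
  constructor
  · rintro ⟨h1, rfl⟩; exact h1
  · intro hi
    have := hT p hi
    simp only [Finset.mem_filter, Finset.mem_univ, true_and] at this
    exact ⟨this.symm ▸ hi, this⟩

/-- Partial sums over up-sets are inverted by recursion from the strongest classes downwards. This
makes the shift order antisymmetric. -/
theorem eq_of_partialSum_eq {G : SimpleGame n} {a b : G.PlayerClass → ℕ}
    (h : ∀ p, G.partialSum a p = G.partialSum b p) : a = b := by
  classical
  have key : ∀ (k : ℕ) (j : Fin n), G.upCount Finset.univ j = k →
      a (G.classOf j) = b (G.classOf j) := by
    intro k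
    induction k using Nat.strong_induction_on with
    | _ k ih =>
    intro j hj
    have hmem : G.classOf j ∈ Finset.univ.filter fun q => G.ClassGE q (G.classOf j) := by
      simpa using (G.classGE_classOf j j).2 (G.desirable_refl j)
    have hs := h (G.classOf j)
    unfold partialSum at hs
    rw [← Finset.add_sum_erase _ _ hmem, ← Finset.add_sum_erase _ _ hmem] at hs
    have : ∑ q ∈ (Finset.univ.filter fun q => G.ClassGE q (G.classOf j)).erase (G.classOf j), a q
        = ∑ q ∈ (Finset.univ.filter fun q => G.ClassGE q (G.classOf j)).erase (G.classOf j),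
          b q := by
      refine Finset.sum_congr rfl fun q hq => ?_
      obtain ⟨i, rfl⟩ := G.exists_classOf_eq q
      simp only [Finset.mem_erase, Finset.mem_filter, Finset.mem_univ, true_and,
        classGE_classOf] at hq
      refine ih _ ?_ i rfl
      rw [← hj]
      refine Finset.card_lt_card (Finset.ssubset_iff_of_subset (fun x hx => ?_) |>.2 ⟨j, ?_, ?_⟩)
      · simp only [Finset.mem_filter, Finset.mem_univ, true_and] at hx ⊢
        exact G.desirable_trans hx hq.2
      · simpa using G.desirable_refl j
      · simp only [Finset.mem_filter, Finset.mem_univ, true_and]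
        exact fun hji => hq.1 (Quotient.sound ⟨hq.2, hji⟩)
    omega
  funext p
  obtain ⟨i, rfl⟩ := G.exists_classOf_eq p
  exact key _ i rfl

theorem coalitionType_eq_of_dominates {G : SimpleGame n} {S T : Finset (Fin n)}
    (h₁ : G.Dominates S T) (h₂ : G.Dominates T S) : G.coalitionType S = G.coalitionType T := by
  refine eq_of_partialSum_eq fun p => le_antisymm ?_ ?_
  · exact (G.shiftGE_coalitionType _ _).2 h₂ p
  · exact (G.shiftGE_coalitionType _ _).2 h₁ p

theorem dominates_of_coalitionType_eq {G : SimpleGame n} {S T : Finset (Fin n)}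
    (h : G.coalitionType S = G.coalitionType T) : G.Dominates S T :=
  (G.shiftGE_coalitionType _ _).1 (h ▸ fun _ => le_rfl)

theorem Dominates.trans {G : SimpleGame n} {S T U : Finset (Fin n)}
    (h₁ : G.Dominates S T) (h₂ : G.Dominates T U) : G.Dominates S U :=
  fun p => (h₂ p).trans (h₁ p)

theorem isShiftMinimalWinningVector_coalitionType {G : SimpleGame n} (hG : G.IsComplete)
    (T : Finset (Fin n)) :
    G.IsShiftMinimalWinningVector (G.coalitionType T) ↔
      T ∈ G.winning ∧ ∀ U ∈ G.winning, G.Dominates T U → G.Dominates U T := by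
  constructor
  · rintro ⟨⟨_, hT⟩, hmin⟩
    refine ⟨hT T rfl, fun U hU hd => ?_⟩
    by_contra hne
    refine (hmin _ (G.isVector_coalitionType U) ((G.shiftGE_coalitionType _ _).2 hd) ?_).2
      U rfl hU
    exact fun e => hne (dominates_of_coalitionType_eq e.symm)
  · rintro ⟨hT, hmin⟩
    refine ⟨⟨G.isVector_coalitionType T, fun S hS =>
      (dominates_of_coalitionType_eq hS).winning hG hT⟩, fun m' hm' hd hne => ?_⟩
    refine ⟨hm', ?_⟩
    rintro U rfl hU
    have hd' := (G.shiftGE_coalitionType _ _).1 hd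
    exact hne (coalitionType_eq_of_dominates hd' (hmin U hU hd'))

/-- Every winning coalition dominates one of shift-minimal type, by finite descent, so uniqueness of
that type means a least winning type. This form mentions no classes and passes easily through
isomorphisms. -/
theorem ncard_shiftMinimal_eq_one_iff {G : SimpleGame n} (hG : G.IsComplete) :
    {m | G.IsShiftMinimalWinningVector m}.ncard = 1 ↔
      ∃ M, ∀ S, S ∈ G.winning ↔ G.Dominates S M := by
  classical
  rw [Set.ncard_eq_one]
  constructor
  · rintro ⟨m, hm⟩
    have hmm : G.IsShiftMinimalWinningVector m := by
      have : m ∈ ({m} : Set _) := rfl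
      rwa [← hm] at this
    obtain ⟨M, rfl⟩ := hmm.1.1.exists_coalitionType_eq
    have hM := (isShiftMinimalWinningVector_coalitionType hG M).1 hmm
    refine ⟨M, fun S => ⟨fun hS => ?_, fun h => h.winning hG hM.1⟩⟩
    obtain ⟨T, hT, hTmin⟩ := Finset.exists_min_image
      (Finset.univ.filter fun T => T ∈ G.winning ∧ G.Dominates S T)
      (fun T => ∑ p, G.upCount T p) ⟨S, by simp only [Finset.mem_filter, Finset.mem_univ, true_and]; exact ⟨hS, fun p => le_rfl⟩⟩
    simp only [Finset.mem_filter, Finset.mem_univ, true_and] at hT hTmin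
    have hTm : G.coalitionType T ∈ {m | G.IsShiftMinimalWinningVector m} := by
      refine (isShiftMinimalWinningVector_coalitionType hG T).2 ⟨hT.1, fun U hU hd => ?_⟩
      have hle := hTmin U ⟨hU, hT.2.trans hd⟩
      have heq := (Finset.sum_eq_sum_iff_of_le fun p _ => hd p).1
        (le_antisymm (Finset.sum_le_sum fun p _ => hd p) hle)
      exact fun p => (heq p (Finset.mem_univ p)).ge
    rw [hm] at hTm
    exact hT.2.trans (dominates_of_coalitionType_eq hTm)
  · rintro ⟨M, hM⟩
    have hMw : M ∈ G.winning := (hM M).2 fun _ => le_rfl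
    refine ⟨G.coalitionType M, Set.ext fun m => ?_⟩
    simp only [Set.mem_ofPred_eq, Set.mem_singleton_iff]
    constructor
    · intro hm
      obtain ⟨T, rfl⟩ := hm.1.1.exists_coalitionType_eq
      obtain ⟨hT, hmin⟩ := (isShiftMinimalWinningVector_coalitionType hG T).1 hm
      have hd := (hM T).1 hT
      exact coalitionType_eq_of_dominates hd (hmin M hMw hd)
    · rintro rfl
      exact (isShiftMinimalWinningVector_coalitionType hG M).2
        ⟨hMw, fun U hU _ => (hM U).1 hU⟩

/-! ### Prefix counts and the game generated by a coalition -/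

/-- The number of members of `S` among the first `k` players. -/
def prefixCount (S : Finset (Fin n)) (k : ℕ) : ℕ := (S.filter fun i => i.val < k).card

theorem prefixCount_zero (S : Finset (Fin n)) : prefixCount S 0 = 0 := by
  simp [prefixCount]

theorem prefixCount_succ (S : Finset (Fin n)) (k : Fin n) :
    prefixCount S (k + 1) = prefixCount S k + if k ∈ S then 1 else 0 := by
  unfold prefixCount
  split_ifs with h
  · have : S.filter (fun i => i.val < k.val + 1) = insert k (S.filter fun i => i.val < k.val) := by
      ext i; simp only [Finset.mem_filter, Finset.mem_insert, Fin.ext_iff]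
      constructor
      · rintro ⟨h1, h2⟩
        rcases Nat.lt_succ_iff_lt_or_eq.1 h2 with h3 | h3
        · exact Or.inr ⟨h1, h3⟩
        · exact Or.inl h3
      · rintro (h1 | h1)
        · exact ⟨by rwa [Fin.ext h1], by omega⟩
        · exact ⟨h1.1, by omega⟩
    rw [this, Finset.card_insert_of_notMem (by simp)]
  · rw [add_zero]
    congr 1
    ext i; simp only [Finset.mem_filter]
    refine and_congr_right fun hi => ?_
    have : i.val ≠ k.val := fun e => h (Fin.ext e ▸ hi)
    omega

theorem prefixCount_mono (S : Finset (Fin n)) : Monotone (prefixCount S) := by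
  intro k l h
  refine Finset.card_le_card fun i hi => ?_
  simp only [Finset.mem_filter] at hi ⊢
  exact ⟨hi.1, hi.2.trans_le h⟩

theorem prefixCount_le_add (S : Finset (Fin n)) (k d : ℕ) :
    prefixCount S (k + d) ≤ prefixCount S k + d := by
  induction d with
  | zero => simp
  | succ d ih =>
    rcases lt_or_ge (k + d) n with h | h
    · have := prefixCount_succ S ⟨k + d, h⟩
      simp only at this
      rw [← add_assoc, this]
      split_ifs <;> omega
    · have : prefixCount S (k + (d + 1)) ≤ prefixCount S (k + d) := by
        refine Finset.card_le_card fun i hi => ?_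
        simp only [Finset.mem_filter] at hi ⊢
        exact ⟨hi.1, i.2.trans_le h⟩
      omega

theorem prefixCount_subset {S T : Finset (Fin n)} (h : S ⊆ T) (k : ℕ) :
    prefixCount S k ≤ prefixCount T k :=
  Finset.card_le_card (Finset.filter_subset_filter _ h)

theorem prefixCount_self (S : Finset (Fin n)) : prefixCount S n = S.card := by
  simp [prefixCount]

theorem prefixCount_of_le (S : Finset (Fin n)) {k : ℕ} (h : n ≤ k) :
    prefixCount S k = prefixCount S n := by
  unfold prefixCount
  congr 1
  ext i
  simp only [Finset.mem_filter]
  have := i.2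
  refine and_congr_right fun _ => ⟨fun _ => this, fun _ => this.trans_le h⟩

theorem eq_of_prefixCount_eq {S T : Finset (Fin n)}
    (h : ∀ k, prefixCount S k = prefixCount T k) : S = T := by
  ext i
  have h1 := prefixCount_succ S i
  have h2 := prefixCount_succ T i
  rw [h, h] at h1
  by_cases hS : i ∈ S <;> by_cases hT : i ∈ T <;> simp_all

/-- Replacing a player by an absent one moves one unit of the prefix counts. -/
theorem prefixCount_insert_erase {S : Finset (Fin n)} {i j : Fin n} (hi : i ∉ S) (hj : j ∈ S)
    (k : ℕ) : prefixCount (insert i (S.erase j)) k + (if j.val < k then 1 else 0)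
      = prefixCount S k + (if i.val < k then 1 else 0) := by
  unfold prefixCount
  have hij : i ≠ j := fun e => hi (e ▸ hj)
  rw [Finset.filter_insert, Finset.filter_erase]
  split_ifs with h1 h2 h2
  · rw [Finset.card_insert_of_notMem (by simp [hi]), Finset.card_erase_add_one (by simp [hj, h2])]
  · rw [Finset.card_insert_of_notMem (by simp [hi]), Finset.erase_eq_of_notMem (by simp [h2])]
  · rw [Finset.card_erase_add_one (by simp [*])]; simp
  · rw [Finset.erase_eq_of_notMem (by simp [*])]

/-- The game generated by a non-empty coalition `M`: a coalition wins if each of its prefix counts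
is at least that of `M`. -/
def shiftGame (M : {M : Finset (Fin n) // M.Nonempty}) : SimpleGame n where
  winning := {S | ∀ k, prefixCount M.1 k ≤ prefixCount S k}
  empty_notMem := by
    intro h
    have := h n
    rw [prefixCount_self, prefixCount_self, Finset.card_empty, Nat.le_zero,
      Finset.card_eq_zero] at this
    exact M.2.ne_empty this
  univ_mem := fun k => prefixCount_subset (Finset.subset_univ _) k
  mono := fun _ _ hS h k => (hS k).trans (prefixCount_subset h k)

theorem mem_shiftGame {M : {M : Finset (Fin n) // M.Nonempty}} {S : Finset (Fin n)} :
    S ∈ (shiftGame M).winning ↔ ∀ k, prefixCount M.1 k ≤ prefixCount S k := Iff.rfl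

theorem self_mem_shiftGame (M : {M : Finset (Fin n) // M.Nonempty}) :
    M.1 ∈ (shiftGame M).winning := fun _ => le_rfl

theorem shiftGame_insert_erase {M : {M : Finset (Fin n) // M.Nonempty}} {S : Finset (Fin n)}
    {i j : Fin n} (hS : S ∈ (shiftGame M).winning) (hi : i ∉ S) (hj : j ∈ S) (hij : i ≤ j) :
    insert i (S.erase j) ∈ (shiftGame M).winning := by
  intro k
  have := prefixCount_insert_erase hi hj k
  have h2 := hS k
  have : i.val ≤ j.val := hij
  split_ifs at * <;> omega

/-! ### Sorted games -/

/-- The players are numbered by decreasing desirability. -/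
def IsSorted (G : SimpleGame n) : Prop := ∀ i j : Fin n, i ≤ j → G.Desirable i j

theorem isSorted_shiftGame (M : {M : Finset (Fin n) // M.Nonempty}) :
    (shiftGame M).IsSorted := fun _ _ hij =>
  desirable_of_insert_erase fun _ hS hi hj => shiftGame_insert_erase hS hi hj hij

theorem IsSorted.isComplete {G : SimpleGame n} (h : G.IsSorted) : G.IsComplete := fun i j =>
  (le_total i j).imp (h i j) (h j i)

/-- In a sorted game, the players at least as desirable as `p` form an initial segment. -/
theorem IsSorted.exists_upCount_eq {G : SimpleGame n} (h : G.IsSorted) (p : Fin n) :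
    ∃ q : Fin n, p ≤ q ∧ G.Desirable q p ∧ ∀ S, G.upCount S p = prefixCount S (q + 1) := by
  classical
  obtain ⟨q, hq, hmax⟩ := Finset.exists_max_image
    (Finset.univ.filter fun i => G.Desirable i p) id ⟨p, by simpa using G.desirable_refl p⟩
  simp only [Finset.mem_filter, Finset.mem_univ, true_and, id] at hq hmax
  refine ⟨q, hmax p (G.desirable_refl p), hq, fun S => ?_⟩
  unfold upCount prefixCount
  congr 1
  ext i
  simp only [Finset.mem_filter]
  refine and_congr_right fun _ => ⟨fun hi => Nat.lt_succ_of_le (hmax i hi), fun hi => ?_⟩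
  exact G.desirable_trans (h i q (Nat.lt_succ_iff.1 hi)) hq

theorem IsSorted.dominates_of_prefixCount {G : SimpleGame n} (h : G.IsSorted)
    {S T : Finset (Fin n)} (hST : ∀ k, prefixCount T k ≤ prefixCount S k) : G.Dominates S T := by
  intro p
  obtain ⟨q, -, -, hq⟩ := h.exists_upCount_eq p
  simpa only [hq] using hST _

theorem ncard_shiftMinimal_shiftGame (M : {M : Finset (Fin n) // M.Nonempty}) :
    {m | (shiftGame M).IsShiftMinimalWinningVector m}.ncard = 1 := by
  have hs := isSorted_shiftGame M
  refine (ncard_shiftMinimal_eq_one_iff hs.isComplete).2 ⟨M.1, fun S => ⟨fun hS => ?_, fun hS => ?_⟩⟩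
  · exact hs.dominates_of_prefixCount hS
  · exact hS.winning hs.isComplete (self_mem_shiftGame M)

/-- A sorted game with one shift-minimal winning vector is generated by a coalition. -/
theorem IsSorted.exists_eq_shiftGame {G : SimpleGame n} (h : G.IsSorted)
    (h1 : {m | G.IsShiftMinimalWinningVector m}.ncard = 1) : ∃ M, G = shiftGame M := by
  classical
  obtain ⟨M₀, hM₀⟩ := (ncard_shiftMinimal_eq_one_iff h.isComplete).1 h1
  have hM₀w : M₀ ∈ G.winning := (hM₀ M₀).2 fun _ => le_rfl
  -- `M₀` only fixes a type. Minimal prefix counts push its members to the right within their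
  -- classes.
  obtain ⟨M, hM, hmin⟩ := Finset.exists_min_image
    (Finset.univ.filter fun T => T ∈ G.winning ∧ G.Dominates M₀ T)
    (fun T => ∑ i : Fin n, prefixCount T (i + 1))
    ⟨M₀, by simp only [Finset.mem_filter, Finset.mem_univ, true_and]; exact ⟨hM₀w, fun p => le_rfl⟩⟩
  simp only [Finset.mem_filter, Finset.mem_univ, true_and] at hM hmin
  have hne : M.Nonempty := by
    rw [Finset.nonempty_iff_ne_empty]
    rintro rfl
    exact G.empty_notMem hM.1
  refine ⟨⟨M, hne⟩, SimpleGame.ext (Set.ext fun S => ?_)⟩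
  rw [mem_shiftGame]
  refine ⟨fun hS => ?_, fun hS => (h.dominates_of_prefixCount hS).winning h.isComplete hM.1⟩
  by_contra! hcon
  obtain ⟨k, hk⟩ := hcon
  simp only at hk
  -- the last index at which `S` falls short of `M`
  obtain ⟨j, hj, hjmax⟩ := Finset.exists_max_image
    (Finset.univ.filter fun j : Fin n => prefixCount S (j + 1) < prefixCount M (j + 1)) id (by
      rcases k with _ | k
      · simp [prefixCount_zero] at hk
      · rcases lt_or_ge k n with hkn | hkn
        · exact ⟨⟨k, hkn⟩, by simpa using hk⟩
        · rcases n with _ | n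
          · exact absurd hne (by simp [Finset.eq_empty_of_isEmpty M])
          · rw [prefixCount_of_le _ (by omega), prefixCount_of_le M (by omega)] at hk
            exact ⟨⟨n, by omega⟩, by simpa using hk⟩)
  simp only [Finset.mem_filter, Finset.mem_univ, true_and, id] at hj hjmax
  have hSM : G.Dominates S M := ((hM₀ S).1 hS).trans hM.2
  -- the last member of `M` up to `j`
  obtain ⟨l, hl, hlmax⟩ := Finset.exists_max_image (M.filter fun i => i.val < j.val + 1) id (by
    rw [← Finset.card_pos]
    exact lt_of_le_of_lt (Nat.zero_le _) hj)
  simp only [Finset.mem_filter, id] at hl hlmax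
  have hSM : G.Dominates S M := ((hM₀ S).1 hS).trans hM.2
  obtain ⟨r, hlr, hrl, hr⟩ := h.exists_upCount_eq l
  -- `r` is the last player at least as desirable as `l`. If it came no later than `j`, the
  -- shortfall of `S` would persist up to `r` and contradict domination at `l`.
  have hjr : j < r := by
    by_contra! hrj
    have h2 := hSM l
    rw [hr, hr] at h2
    have h3 : prefixCount S (r + 1) ≤ prefixCount S (j + 1) :=
      prefixCount_mono S (Nat.succ_le_succ hrj)
    have h4 : prefixCount M (j + 1) ≤ prefixCount M (r + 1) := by
      refine Finset.card_le_card fun i hi => ?_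
      simp only [Finset.mem_filter] at hi ⊢
      exact ⟨hi.1, Nat.lt_succ_of_le ((hlmax i hi).trans hlr)⟩
    omega
  have hjn : j.val + 1 < n := lt_of_le_of_lt hjr r.2
  let j' : Fin n := ⟨j.val + 1, hjn⟩
  -- A member of `M` at `j + 1` would carry the shortfall one index beyond the last. So `l` can be
  -- moved right to `j'`, against minimality.
  have hj'M : j' ∉ M := by
    intro hmem
    have hle : ¬ (prefixCount S (j' + 1) < prefixCount M (j' + 1)) := fun hlt => by
      have : j.val + 1 ≤ j.val := hjmax j' hlt
      omega
    have e1 := prefixCount_succ S j'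
    have e2 := prefixCount_succ M j'
    rw [if_pos hmem] at e2
    have : prefixCount S j' < prefixCount M j' := hj
    split_ifs at e1 <;> omega
  have hlj : l.val < j'.val := hl.2
  have hdes : G.Desirable j' l := G.desirable_trans (h j' r hjr) hrl
  have hcount := prefixCount_insert_erase hj'M hl.1
  have hle : ∀ k, prefixCount (insert j' (M.erase l)) k ≤ prefixCount M k := by
    intro k
    have := hcount k
    split_ifs at this <;> omega
  refine absurd (hmin (insert j' (M.erase l)) ⟨hdes.insert_erase_mem hM.1 hj'M hl.1,
    hM.2.trans (h.dominates_of_prefixCount hle)⟩) (not_le.2 ?_)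
  refine Finset.sum_lt_sum (fun i _ => hle _) ⟨l, Finset.mem_univ _, ?_⟩
  have := hcount (l + 1)
  rw [if_pos (by omega), if_neg (by omega)] at this
  omega

/-! ### Isomorphisms and the sorted normal form -/

/-- The number of players at least as desirable as `j`. -/
noncomputable def rank (G : SimpleGame n) (j : Fin n) : ℕ := G.upCount Finset.univ j

theorem rank_le_rank {G : SimpleGame n} {i j : Fin n} (h : G.Desirable i j) :
    G.rank i ≤ G.rank j := by
  unfold rank upCount
  refine Finset.card_le_card fun x hx => ?_
  simp only [Finset.mem_filter, Finset.mem_univ, true_and] at hx ⊢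
  exact G.desirable_trans hx h

theorem desirable_iff_rank_le {G : SimpleGame n} (hG : G.IsComplete) {i j : Fin n} :
    G.Desirable i j ↔ G.rank i ≤ G.rank j := by
  refine ⟨rank_le_rank, fun h => ?_⟩
  rcases hG i j with h1 | h1
  · exact h1
  by_contra h2
  unfold rank upCount at h
  refine absurd h (not_le.2 (Finset.card_lt_card ?_))
  refine Finset.ssubset_iff_of_subset (fun y hy => ?_) |>.2 ⟨i, ?_, ?_⟩
  · simp only [Finset.mem_filter, Finset.mem_univ, true_and] at hy ⊢
    exact G.desirable_trans hy h1
  · simpa using G.desirable_refl i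
  · simpa using h2

/-- `f` carries the winning coalitions of `G` exactly to those of `H`. -/
def IsIso (G H : SimpleGame n) (f : Fin n ≃ Fin n) : Prop :=
  ∀ S : Finset (Fin n), S ∈ G.winning ↔ S.map f.toEmbedding ∈ H.winning

theorem IsIso.desirable_iff {G H : SimpleGame n} {f : Fin n ≃ Fin n} (hf : G.IsIso H f)
    (i j : Fin n) : G.Desirable i j ↔ H.Desirable (f i) (f j) := by
  have hmap : ∀ S : Finset (Fin n), (S.map (Equiv.swap i j).toEmbedding).map f.toEmbedding
      = (S.map f.toEmbedding).map (Equiv.swap (f i) (f j)).toEmbedding := by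
    intro S
    rw [Finset.map_map, Finset.map_map]
    congr 1
    ext x
    simp [Equiv.swap_apply_def, apply_ite f]
  rw [SimpleGame.desirable_iff, SimpleGame.desirable_iff]
  constructor
  · intro h S hS hj
    obtain ⟨T, rfl⟩ : ∃ T : Finset (Fin n), S = T.map f.toEmbedding :=
      ⟨S.map f.symm.toEmbedding, by simp [Finset.map_map]⟩
    rw [← hmap, ← hf]
    exact h T ((hf T).2 hS) (by simpa using hj)
  · intro h S hS hj
    rw [hf, hmap]
    exact h _ ((hf S).1 hS) (by simpa using hj)

theorem IsIso.upCount_eq {G H : SimpleGame n} {f : Fin n ≃ Fin n} (hf : G.IsIso H f)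
    (S : Finset (Fin n)) (p : Fin n) : G.upCount S p = H.upCount (S.map f.toEmbedding) (f p) := by
  classical
  unfold upCount
  rw [Finset.filter_map, Finset.card_map]
  congr 1
  ext x
  simp [hf.desirable_iff]

theorem IsIso.dominates_iff {G H : SimpleGame n} {f : Fin n ≃ Fin n} (hf : G.IsIso H f)
    (S T : Finset (Fin n)) :
    G.Dominates S T ↔ H.Dominates (S.map f.toEmbedding) (T.map f.toEmbedding) := by
  constructor
  · intro h p
    obtain ⟨p, rfl⟩ := f.surjective p
    simpa only [hf.upCount_eq] using h p
  · intro h p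
    simpa only [hf.upCount_eq] using h (f p)

theorem IsIso.isWeighted {G H : SimpleGame n} {f : Fin n ≃ Fin n} (hf : G.IsIso H f)
    (hH : H.IsWeighted) : G.IsWeighted := by
  obtain ⟨q, w, hq, hw, h⟩ := hH
  exact ⟨q, fun i => w (f i), hq, fun i => hw _, fun S => by rw [hf, h, Finset.sum_map]; rfl⟩

theorem IsIso.ncard_shiftMinimal {G H : SimpleGame n} {f : Fin n ≃ Fin n} (hf : G.IsIso H f)
    (hG : G.IsComplete) (hH : H.IsComplete)
    (h : {m | H.IsShiftMinimalWinningVector m}.ncard = 1) :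
    {m | G.IsShiftMinimalWinningVector m}.ncard = 1 := by
  rw [ncard_shiftMinimal_eq_one_iff hG]
  obtain ⟨M, hM⟩ := (ncard_shiftMinimal_eq_one_iff hH).1 h
  refine ⟨M.map f.symm.toEmbedding, fun S => ?_⟩
  rw [hf, hM, hf.dominates_iff, Finset.map_map]
  simp

/-- The game `G` with its players renumbered. -/
def renumber (G : SimpleGame n) (f : Fin n ≃ Fin n) : SimpleGame n where
  winning := {S | S.map f.toEmbedding ∈ G.winning}
  empty_notMem := by simpa using G.empty_notMem
  univ_mem := by simpa using G.univ_mem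
  mono := fun _ _ hS h => G.mono _ _ hS (Finset.map_subset_map.2 h)

theorem isIso_renumber (G : SimpleGame n) (f : Fin n ≃ Fin n) : (G.renumber f).IsIso G f :=
  fun _ => Iff.rfl

theorem IsComplete.exists_isSorted_renumber {G : SimpleGame n} (hG : G.IsComplete) :
    ∃ f, (G.renumber f).IsSorted := by
  refine ⟨Tuple.sort G.rank, fun i j hij => ?_⟩
  rw [(isIso_renumber G _).desirable_iff, desirable_iff_rank_le hG]
  exact Tuple.monotone_sort G.rank hij

/-- Isomorphisms preserve ranks, and both rank sequences are monotone, hence equal. So `f` moves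
players only within classes of `H`, which changes no up-count. -/
theorem eq_of_isIso_of_isSorted {G H : SimpleGame n} {f : Fin n ≃ Fin n} (hf : G.IsIso H f)
    (hG : G.IsSorted) (hH : H.IsSorted) : G = H := by
  classical
  have hrank : ∀ i, G.rank i = H.rank (f i) := fun i => by
    unfold rank
    rw [hf.upCount_eq]
    simp
  have hr : H.rank ∘ f = H.rank ∘ Equiv.refl _ := by
    refine Tuple.unique_monotone ?_ ?_
    · intro i j hij
      simpa only [Function.comp, ← hrank] using rank_le_rank (hG i j hij)
    · intro i j hij
      exact rank_le_rank (hH i j hij)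
  have hfr : ∀ i, H.rank (f i) = H.rank i := fun i => congrFun hr i
  have hcount : ∀ S p, H.upCount (S.map f.toEmbedding) p = H.upCount S p := by
    intro S p
    unfold upCount
    rw [Finset.filter_map, Finset.card_map]
    congr 1
    ext x
    simp [desirable_iff_rank_le hH.isComplete, hfr]
  refine SimpleGame.ext (Set.ext fun S => ?_)
  rw [hf]
  constructor <;> intro h
  · exact Dominates.winning hH.isComplete (fun p => (hcount S p).le) h
  · exact Dominates.winning hH.isComplete (fun p => (hcount S p).ge) h

theorem shiftGame_injective : Function.Injective (shiftGame (n := n)) := by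
  intro M M' h
  have h1 : M.1 ∈ (shiftGame M').winning := h ▸ self_mem_shiftGame M
  have h2 : M'.1 ∈ (shiftGame M).winning := h ▸ self_mem_shiftGame M'
  exact Subtype.ext (eq_of_prefixCount_eq fun k => le_antisymm (h2 k) (h1 k))

theorem numWeighted_one (n : ℕ) : numWeighted n 1
    = {M : {M : Finset (Fin n) // M.Nonempty} | (shiftGame M).IsWeighted}.ncard := by
  have hset : (Quotient.mk (isoSetoid n) '' {G : SimpleGame n | G.IsWeighted ∧
      {m | G.IsShiftMinimalWinningVector m}.ncard = 1})
      = (fun M => Quotient.mk (isoSetoid n) (shiftGame M)) ''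
        {M : {M : Finset (Fin n) // M.Nonempty} | (shiftGame M).IsWeighted} := by
    ext x
    constructor
    · rintro ⟨G, ⟨hw, h1⟩, rfl⟩
      obtain ⟨f, hf⟩ := hw.isComplete.exists_isSorted_renumber
      have hiso := isIso_renumber G f
      obtain ⟨M, hM⟩ := hf.exists_eq_shiftGame
        (hiso.ncard_shiftMinimal hf.isComplete hw.isComplete h1)
      refine ⟨M, ?_, Quotient.sound ⟨f, ?_⟩⟩
      · change (shiftGame M).IsWeighted
        rw [← hM]
        exact hiso.isWeighted hw
      · rw [← hM]
        exact hiso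
    · rintro ⟨M, hM, rfl⟩
      exact ⟨_, ⟨hM, ncard_shiftMinimal_shiftGame M⟩, rfl⟩
  unfold numWeighted
  rw [hset, Set.ncard_image_of_injective]
  intro M M' h
  obtain ⟨f, hf⟩ : (shiftGame M).Isomorphic (shiftGame M') := Quotient.exact h
  exact shiftGame_injective
    (eq_of_isIso_of_isSorted hf (isSorted_shiftGame M) (isSorted_shiftGame M'))

/-! ### Trades that exclude weights -/

theorem sum_insert_erase {S : Finset (Fin n)} {i j : Fin n} (w : Fin n → ℝ) (hi : i ∉ S)
    (hj : j ∈ S) : ∑ x ∈ insert i (S.erase j), w x = ∑ x ∈ S, w x + w i - w j := by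
  rw [Finset.sum_insert (by simp [hi]), ← Finset.add_sum_erase S w hj]
  ring

/-- Two winning coalitions can be traded for two losing ones if members `o₁, o₂, o₃` and
non-members `z₁, z₂, z₃` of the generating coalition interlace suitably. -/
theorem not_isWeighted_shiftGame {M : {M : Finset (Fin n) // M.Nonempty}}
    {z₁ z₂ z₃ o₁ o₂ o₃ : Fin n} (hz₁ : z₁ ∉ M.1) (hz₂ : z₂ ∉ M.1) (hz₃ : z₃ ∉ M.1)
    (ho₁ : o₁ ∈ M.1) (ho₂ : o₂ ∈ M.1) (ho₃ : o₃ ∈ M.1) (h₁ : z₁ < o₁) (h₂ : o₁ < z₂)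
    (h₃ : z₂ < z₃) (h₄ : z₃ < o₃) (h₅ : z₂ < o₂) (h₆ : o₂ < o₃) :
    ¬ (shiftGame M).IsWeighted := by
  rintro ⟨q, w, -, -, hw⟩
  obtain ⟨M, hM⟩ := M
  simp only at hz₁ hz₂ hz₃ ho₁ ho₂ ho₃
  have hself := self_mem_shiftGame ⟨M, hM⟩
  -- the second winning coalition
  have a1 := shiftGame_insert_erase hself hz₁ ho₁ h₁.le
  have m2 : z₂ ∉ insert z₁ (M.erase o₁) := by grind
  have n2 : o₂ ∈ insert z₁ (M.erase o₁) := by grind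
  have a2 := shiftGame_insert_erase a1 m2 n2 h₅.le
  have m3 : z₃ ∉ insert z₂ ((insert z₁ (M.erase o₁)).erase o₂) := by grind
  have n3 : o₃ ∈ insert z₂ ((insert z₁ (M.erase o₁)).erase o₂) := by grind
  have a3 := shiftGame_insert_erase a2 m3 n3 h₄.le
  rw [hw, sum_insert_erase w m3 n3, sum_insert_erase w m2 n2, sum_insert_erase w hz₁ ho₁] at a3
  rw [hw] at hself
  -- the first losing coalition
  have k2 : z₂ ∉ M.erase o₁ := by grind
  have k3 : z₃ ∉ insert z₂ (M.erase o₁) := by grind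
  have b1 : insert z₃ (insert z₂ (M.erase o₁)) ∉ (shiftGame ⟨M, hM⟩).winning := by
    intro h
    refine absurd (h (o₁ + 1)) (not_le.2 (Finset.card_lt_card ?_))
    refine Finset.ssubset_iff_of_subset (fun x hx => ?_) |>.2 ⟨o₁, by simp [ho₁], ?_⟩
    · simp only [Finset.mem_filter, Finset.mem_insert, Finset.mem_erase] at hx ⊢
      refine ⟨?_, hx.2⟩
      rcases hx.1 with rfl | rfl | hx1
      · exact absurd hx.2 (by omega)
      · exact absurd hx.2 (by omega)
      · exact hx1.2
    · have := h₂.trans h₃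
      simp [h₂.ne, this.ne]
  rw [hw, Finset.sum_insert k3, Finset.sum_insert k2, Finset.sum_erase_eq_sub ho₁, not_le] at b1
  -- the second losing coalition
  have l2 : o₃ ∈ insert z₁ (M.erase o₂) := by grind
  have b2 : (insert z₁ (M.erase o₂)).erase o₃ ∉ (shiftGame ⟨M, hM⟩).winning := by
    intro h
    have h1 := h n
    rw [prefixCount_self, prefixCount_self, Finset.card_erase_of_mem l2,
      Finset.card_insert_of_notMem (by simp [hz₁]), Finset.card_erase_of_mem ho₂] at h1
    have := Finset.card_pos.2 hM
    simp only at h1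
    omega
  rw [hw, Finset.sum_erase_eq_sub l2, sum_insert_erase w hz₁ ho₂, not_le] at b2
  -- The two winning coalitions together use each player as often as the two losing ones, so the
  -- total weight would be both at least and less than `2q`.
  linarith

/-! ### Weights for the block words -/

theorem prefixCount_word {M : Finset (Fin n)} {x a b c d : ℕ}
    (hM : ∀ i : Fin n, i ∈ M ↔ i.val < x ∨ (x + a ≤ i.val ∧ i.val < x + a + b) ∨
      (x + a + b + c ≤ i.val ∧ i.val < x + a + b + c + d)) (k : ℕ) (hk : k ≤ n) :
    prefixCount M k = min k x + (min k (x + a + b) - (x + a))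
        + (min k (x + a + b + c + d) - (x + a + b + c)) := by
  induction k with
  | zero => simp [prefixCount_zero]
  | succ k ih =>
    have h1 := prefixCount_succ M ⟨k, hk⟩
    have h2 := hM ⟨k, hk⟩
    have h3 := ih (by omega)
    simp only at h1 h2
    by_cases hm : (⟨k, hk⟩ : Fin n) ∈ M
    · rw [if_pos hm] at h1
      have h4 := h2.1 hm
      clear h2 hm hM ih
      omega
    · rw [if_neg hm] at h1
      have h4 := mt h2.2 hm
      clear h2 hm hM ih
      omega

/-- Weights for the game generated by the word `1^x 0^a 1^b 0^c 1^d 0^y`. -/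
noncomputable def stepWeight (x a b c d : ℕ) (i : Fin n) : ℝ :=
  if i.val < x then 1 + (a + 1) * (c * d + 1) + c * d
  else if i.val < x + a + b then c * d + 1
  else if i.val < x + a + b + c + d then d else 0

theorem sum_stepWeight (x a b c d : ℕ) (S : Finset (Fin n)) :
    ∑ i ∈ S, stepWeight x a b c d i
      = ((1 + (a + 1) * (c * d + 1) + c * d) - (c * d + 1)) * prefixCount S x
        + (c * d + 1 - d) * prefixCount S (x + a + b)
        + d * prefixCount S (x + a + b + c + d) := by
  unfold prefixCount
  rw [← Finset.sum_boole, ← Finset.sum_boole, ← Finset.sum_boole, Finset.mul_sum, Finset.mul_sum,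
    Finset.mul_sum, ← Finset.sum_add_distrib, ← Finset.sum_add_distrib]
  refine Finset.sum_congr rfl fun i _ => ?_
  unfold stepWeight
  split_ifs <;> first | omega | ring

/-- Here `s`, `u`, `v` are the prefix counts of a coalition at the ends of the three weight levels,
and the threshold is the weight of the generator. Each upper level outweighs all surplus available
below it. -/
theorem stepWeight_quota_iff {x a b c d s u v : ℕ} (hcd : c = 1 ∨ d ≤ 1) (hs : s ≤ x)
    (hu : u ≤ s + a + b) (huv : u ≤ v) (hv : v ≤ u + c + d) :
    (x ≤ s ∧ x + b ≤ u ∧ x + b + d ≤ v) ↔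
      ((1 + (a + 1) * (c * d + 1) + c * d) - (c * d + 1)) * (x : ℝ) + (c * d + 1 - d) * (x + b)
        + d * (x + b + d)
      ≤ ((1 + (a + 1) * (c * d + 1) + c * d) - (c * d + 1)) * s + (c * d + 1 - d) * u + d * v := by
  have hu' : (u : ℝ) ≤ s + a + b := by exact_mod_cast hu
  have hv' : (v : ℝ) ≤ u + c + d := by exact_mod_cast hv
  have hd0 : (0 : ℝ) ≤ d := d.cast_nonneg
  have hc0 : (0 : ℝ) ≤ c := c.cast_nonneg
  have ha0 : (0 : ℝ) ≤ a := a.cast_nonneg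
  have hcd0 : (0 : ℝ) ≤ c * d := mul_nonneg hc0 hd0
  constructor
  · rintro ⟨h1, h2, h3⟩
    obtain rfl : x = s := le_antisymm h1 hs
    have h2' : (0 : ℝ) ≤ u - (x + b) := by
      have : (x : ℝ) + b ≤ u := by exact_mod_cast h2
      linarith
    have h3' : (0 : ℝ) ≤ v - (x + b + d) := by
      have : (x : ℝ) + b + d ≤ v := by exact_mod_cast h3
      linarith
    by_cases hw : (d : ℝ) ≤ c * d + 1
    · nlinarith [mul_nonneg (sub_nonneg.2 hw) h2', mul_nonneg hd0 h3']
    · exfalso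
      apply hw
      rcases hcd with rfl | h
      · simp
      · have : (d : ℝ) ≤ 1 := by exact_mod_cast h
        linarith
  · intro h
    by_contra hcon
    rcases hs.lt_or_eq with h1 | rfl
    -- A missing top player costs more than the possible surplus `a * (c * d + 1) + c * d`.
    · have h1' : (0 : ℝ) ≤ x - 1 - s := by
        have : (s : ℝ) + 1 ≤ x := by exact_mod_cast h1
        linarith
      have e1 := mul_nonneg hd0 (sub_nonneg.2 hv')
      have e2 : 0 ≤ (c * d + 1) * ((s : ℝ) + a + b - u) :=
        mul_nonneg (by linarith) (sub_nonneg.2 hu')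
      have e3 : 0 ≤ (1 + (a + 1) * (c * d + 1) + c * d) * ((x : ℝ) - 1 - s) :=
        mul_nonneg (by positivity) h1'
      nlinarith
    rcases lt_or_ge u (s + b) with h2 | h2
    -- A missing second-level player costs `c * d + 1`, while the third level offers a surplus of at
    -- most `c * d`.
    · have h2' : (0 : ℝ) ≤ s + b - u - 1 := by
        have : (u : ℝ) + 1 ≤ s + b := by exact_mod_cast h2
        linarith
      have e1 := mul_nonneg hd0 (sub_nonneg.2 hv')
      have e2 : 0 ≤ (c * d + 1) * ((s : ℝ) + b - u - 1) := mul_nonneg (by linarith) h2'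
      nlinarith
    · have h3 : v < s + b + d := by
        by_contra h3
        exact hcon ⟨le_rfl, h2, not_lt.1 h3⟩
      have h3' : (0 : ℝ) ≤ s + b + d - v - 1 := by
        have : (v : ℝ) + 1 ≤ s + b + d := by exact_mod_cast h3
        linarith
      have h4 : (u : ℝ) ≤ v := by exact_mod_cast huv
      have h2' : (s : ℝ) + b ≤ u := by exact_mod_cast h2
      -- With `c = 1`, each of the `u - (s + b) < d` extra second-level players gains only `1` over
      -- a third-level one, less than the weight `d` of the missing player. With `d = 1` there is no
      -- such extra player.
      rcases hcd with rfl | hd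
      · push_cast at h
        nlinarith [mul_nonneg hd0 h3']
      · obtain rfl | rfl : d = 0 ∨ d = 1 := by omega
        · omega
        · have : (u : ℝ) = s + b := by exact_mod_cast (by omega : u = s + b)
          rw [this] at h
          push_cast at h h3'
          nlinarith

/-- A game generated by a word `1^x 0^a 1^b 0^c 1^d 0^y` with `c = 1` or `d ≤ 1` is weighted. -/
theorem isWeighted_shiftGame (M : {M : Finset (Fin n) // M.Nonempty}) (x a b c d : ℕ)
    (hn : x + a + b + c + d ≤ n) (hcd : c = 1 ∨ d ≤ 1)
    (hM : ∀ i : Fin n, i ∈ M.1 ↔ i.val < x ∨ (x + a ≤ i.val ∧ i.val < x + a + b) ∨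
      (x + a + b + c ≤ i.val ∧ i.val < x + a + b + c + d)) : (shiftGame M).IsWeighted := by
  have hcount := prefixCount_word hM
  have hpos : 0 < x + b + d := by
    have h1 := hcount n le_rfl
    rw [prefixCount_self] at h1
    have := Finset.card_pos.2 M.2
    omega
  have hwin : ∀ S, S ∈ (shiftGame M).winning ↔ x ≤ prefixCount S x ∧
      x + b ≤ prefixCount S (x + a + b) ∧ x + b + d ≤ prefixCount S (x + a + b + c + d) := by
    intro S
    constructor
    · intro h
      refine ⟨?_, ?_, ?_⟩
      · have h1 := h x
        rw [hcount x (by omega)] at h1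
        omega
      · have h1 := h (x + a + b)
        rw [hcount (x + a + b) (by omega)] at h1
        omega
      · have h1 := h (x + a + b + c + d)
        rw [hcount (x + a + b + c + d) (by omega)] at h1
        omega
    · rintro ⟨h1, h2, h3⟩
      -- Ends of blocks of ones suffice: inside such a block the counts of `S` grow by at most one
      -- per step, and on zeros those of `M` stay constant.
      have main : ∀ k ≤ n, prefixCount M.1 k ≤ prefixCount S k := by
        intro k hk
        rw [hcount k hk]
        have up : ∀ e, k ≤ e → prefixCount S e ≤ prefixCount S k + (e - k) := by
          intro e he
          have := prefixCount_le_add S k (e - k)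
          rwa [Nat.add_sub_cancel' he] at this
        have u1 := up x
        have u2 := up (x + a + b)
        have u3 := up (x + a + b + c + d)
        have v1 := fun h => prefixCount_mono S (a := x) (b := k) h
        have v2 := fun h => prefixCount_mono S (a := x + a + b) (b := k) h
        have v3 := fun h => prefixCount_mono S (a := x + a + b + c + d) (b := k) h
        rcases le_total k x with e | e
        · have := u1 e; omega
        have := v1 e
        rcases le_total k (x + a + b) with e | e
        · have := u2 e; omega
        have := v2 e
        rcases le_total k (x + a + b + c + d) with e | e
        · have := u3 e; omega
        have := v3 e
        omega
      intro k
      rcases le_total k n with hk | hk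
      · exact main k hk
      · rw [prefixCount_of_le _ hk, prefixCount_of_le S hk]
        exact main n le_rfl
  have hsum := sum_stepWeight x a b c d (n := n)
  refine ⟨((1 + (a + 1) * (c * d + 1) + c * d) - (c * d + 1)) * x + (c * d + 1 - d) * (x + b)
      + d * (x + b + d), stepWeight x a b c d, ?_, fun i => ?_, fun S => ?_⟩
  · have : (0 : ℝ) < x + b + d := by exact_mod_cast hpos
    have hx : (0 : ℝ) ≤ x := x.cast_nonneg
    have hb : (0 : ℝ) ≤ b := b.cast_nonneg
    have hd : (0 : ℝ) ≤ d := d.cast_nonneg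
    have hc : (0 : ℝ) ≤ c := c.cast_nonneg
    have ha : (0 : ℝ) ≤ a := a.cast_nonneg
    have e : ((1 + (a + 1) * (c * d + 1) + c * d) - (c * d + 1)) * x
        + (c * d + 1 - d) * (x + b) + d * (x + b + d)
        = x * (1 + (a + 1) * (c * d + 1) + c * d) + b * (c * d + 1) + (d : ℝ) * d := by ring
    rw [e]
    have t1 : (x : ℝ) ≤ x * (1 + (a + 1) * (c * d + 1) + c * d) :=
      le_mul_of_one_le_right hx (by have : 0 ≤ (a + 1) * ((c : ℝ) * d + 1) + c * d := by positivity
                                    linarith)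
    have t2 : (b : ℝ) ≤ b * (c * d + 1) :=
      le_mul_of_one_le_right hb (by have : 0 ≤ (c : ℝ) * d := by positivity
                                    linarith)
    have t3 : (d : ℝ) ≤ d * d := by exact_mod_cast Nat.le_mul_self d
    linarith
  · unfold stepWeight
    split_ifs <;> positivity
  · rw [hwin, hsum]
    refine stepWeight_quota_iff hcd ?_ ?_ ?_ ?_
    · have := prefixCount_le_add S 0 x
      rwa [prefixCount_zero, Nat.zero_add] at this
    · have := prefixCount_le_add S x (a + b)
      rwa [← add_assoc, ← add_assoc] at this
    · exact prefixCount_mono S (by omega)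
    · have := prefixCount_le_add S (x + a + b) (c + d)
      rwa [← add_assoc, ← add_assoc] at this

/-! ### Predicates recognising the words of weighted games -/

/-- Words of the form `0^y`. -/
def isZeros : List Bool → Bool
  | [] => true
  | true :: _ => false
  | false :: l => isZeros l

/-- Words of the form `1^d 0^y`. -/
def isOnesZeros : List Bool → Bool
  | [] => true
  | true :: l => isOnesZeros l
  | false :: l => isZeros l

/-- Words with at most one `1`. -/
def hasAtMostOneOne : List Bool → Bool
  | [] => true
  | true :: l => isZeros l
  | false :: l => hasAtMostOneOne l

/-- Words that continue `1^x 0^a 1^b 0` to a word generating a weighted game. -/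
def isTail : List Bool → Bool
  | [] => true
  | true :: l => isOnesZeros l
  | false :: l => hasAtMostOneOne l

/-- Words of the form `1^b` or `1^b 0 r` with `isTail r`. -/
def isTailOfOnes : List Bool → Bool
  | [] => true
  | true :: l => isTailOfOnes l
  | false :: l => isTail l

/-- Words of the form `0^a r` with `isTailOfOnes r`. -/
def isTailOfZeros : List Bool → Bool
  | [] => true
  | true :: l => isTailOfOnes l
  | false :: l => isTailOfZeros l

/-- The words that generate weighted games, and the words `0^y`. -/
def isWeightedWord : List Bool → Bool
  | [] => true
  | true :: l => isWeightedWord l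
  | false :: l => isTailOfZeros l

/-! ### Words that are not of the required form contain a forbidden pattern -/

theorem sublist_of_not_isZeros {l : List Bool} (h : ¬ isZeros l) : List.Sublist [true] l := by
  fun_induction isZeros l <;> simp_all

theorem sublist_of_not_isOnesZeros {l : List Bool} (h : ¬ isOnesZeros l) :
    List.Sublist [false, true] l := by
  fun_induction isOnesZeros l with
  | case1 => simp at h
  | case2 l ih => exact (ih h).cons _
  | case3 l => exact (sublist_of_not_isZeros h).cons_cons _

theorem sublist_of_not_hasAtMostOneOne {l : List Bool} (h : ¬ hasAtMostOneOne l) :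
    List.Sublist [true, true] l := by
  fun_induction hasAtMostOneOne l with
  | case1 => simp at h
  | case2 l => exact (sublist_of_not_isZeros h).cons_cons _
  | case3 l ih => exact (ih h).cons _

/-- The first letter decides which pattern can arise: after a zero the block of zeros is too long
for two further ones, after a one no new block of ones may follow. -/
theorem sublist_of_not_isTail {l : List Bool} (h : ¬ isTail l) :
    List.Sublist [false, true, true] l ∨ List.Sublist [true, false, true] l := by
  fun_cases isTail l with
  | case1 => simp [isTail] at h
  | case2 l => exact Or.inr ((sublist_of_not_isOnesZeros h).cons_cons _)
  | case3 l => exact Or.inl ((sublist_of_not_hasAtMostOneOne h).cons_cons _)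

theorem sublist_of_not_isTailOfOnes {l : List Bool} (h : ¬ isTailOfOnes l) :
    List.Sublist [false, false, true, true] l ∨ List.Sublist [false, true, false, true] l := by
  fun_induction isTailOfOnes l with
  | case1 => simp at h
  | case2 l ih => exact (ih h).imp (·.cons _) (·.cons _)
  | case3 l => exact (sublist_of_not_isTail h).imp (·.cons_cons _) (·.cons_cons _)

theorem sublist_of_not_isTailOfZeros {l : List Bool} (h : ¬ isTailOfZeros l) :
    List.Sublist [true, false, false, true, true] l ∨ List.Sublist [true, false, true, false, true] l := by
  fun_induction isTailOfZeros l with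
  | case1 => simp at h
  | case2 l => exact (sublist_of_not_isTailOfOnes h).imp (·.cons_cons _) (·.cons_cons _)
  | case3 l ih => exact (ih h).imp (·.cons _) (·.cons _)

theorem sublist_of_not_isWeightedWord {l : List Bool} (h : ¬ isWeightedWord l) :
    List.Sublist [false, true, false, false, true, true] l ∨
      List.Sublist [false, true, false, true, false, true] l := by
  fun_induction isWeightedWord l with
  | case1 => simp at h
  | case2 l ih => exact (ih h).imp (·.cons _) (·.cons _)
  | case3 l => exact (sublist_of_not_isTailOfZeros h).imp (·.cons_cons _) (·.cons_cons _)

/-! ### The shape of the words of the required form -/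

/-- The word `1^x 0^a 1^b 0^c 1^d 0^y`. -/
def blockWord (x a b c d y : ℕ) : List Bool :=
  List.replicate x true ++ (List.replicate a false ++ (List.replicate b true ++
    (List.replicate c false ++ (List.replicate d true ++ List.replicate y false))))

theorem eq_of_isZeros {l : List Bool} (h : isZeros l) : ∃ y, l = blockWord 0 0 0 0 0 y := by
  fun_induction isZeros l with
  | case1 => exact ⟨0, rfl⟩
  | case2 l => simp at h
  | case3 l ih =>
    obtain ⟨y, rfl⟩ := ih h
    exact ⟨y + 1, rfl⟩

theorem eq_of_isOnesZeros {l : List Bool} (h : isOnesZeros l) :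
    ∃ d y, l = blockWord 0 0 0 0 d y := by
  fun_induction isOnesZeros l with
  | case1 => exact ⟨0, 0, rfl⟩
  | case2 l ih =>
    obtain ⟨d, y, rfl⟩ := ih h
    exact ⟨d + 1, y, rfl⟩
  | case3 l =>
    obtain ⟨y, rfl⟩ := eq_of_isZeros h
    exact ⟨0, y + 1, rfl⟩

theorem eq_of_hasAtMostOneOne {l : List Bool} (h : hasAtMostOneOne l) :
    ∃ c d y, d ≤ 1 ∧ l = blockWord 0 0 0 c d y := by
  fun_induction hasAtMostOneOne l with
  | case1 => exact ⟨0, 0, 0, by simp, rfl⟩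
  | case2 l =>
    obtain ⟨y, rfl⟩ := eq_of_isZeros h
    exact ⟨0, 1, y, le_rfl, rfl⟩
  | case3 l ih =>
    obtain ⟨c, d, y, hd, rfl⟩ := ih h
    exact ⟨c + 1, d, y, hd, rfl⟩

theorem eq_of_isTail {l : List Bool} (h : isTail l) :
    ∃ c d y, (c = 0 ∨ d ≤ 1) ∧ l = blockWord 0 0 0 c d y := by
  fun_cases isTail l with
  | case1 => exact ⟨0, 0, 0, by simp, rfl⟩
  | case2 l =>
    obtain ⟨d, y, rfl⟩ := eq_of_isOnesZeros h
    exact ⟨0, d + 1, y, Or.inl rfl, rfl⟩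
  | case3 l =>
    obtain ⟨c, d, y, hd, rfl⟩ := eq_of_hasAtMostOneOne h
    exact ⟨c + 1, d, y, Or.inr hd, rfl⟩

theorem eq_of_isTailOfOnes {l : List Bool} (h : isTailOfOnes l) :
    ∃ b c d y, (c = 1 ∨ d ≤ 1) ∧ l = blockWord 0 0 b c d y := by
  fun_induction isTailOfOnes l with
  | case1 => exact ⟨0, 0, 0, 0, by simp, rfl⟩
  | case2 l ih =>
    obtain ⟨b, c, d, y, hd, rfl⟩ := ih h
    exact ⟨b + 1, c, d, y, hd, rfl⟩
  | case3 l =>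
    obtain ⟨c, d, y, hd, rfl⟩ := eq_of_isTail h
    -- The zero just read joins the block, turning `c = 0` into `c = 1`.
    exact ⟨0, c + 1, d, y, hd.imp_left (congrArg Nat.succ), rfl⟩

theorem eq_of_isTailOfZeros {l : List Bool} (h : isTailOfZeros l) :
    ∃ a b c d y, (c = 1 ∨ d ≤ 1) ∧ l = blockWord 0 a b c d y := by
  fun_induction isTailOfZeros l with
  | case1 => exact ⟨0, 0, 0, 0, 0, by simp, rfl⟩
  | case2 l =>
    obtain ⟨b, c, d, y, hd, rfl⟩ := eq_of_isTailOfOnes h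
    exact ⟨0, b + 1, c, d, y, hd, rfl⟩
  | case3 l ih =>
    obtain ⟨a, b, c, d, y, hd, rfl⟩ := ih h
    exact ⟨a + 1, b, c, d, y, hd, rfl⟩

theorem eq_of_isWeightedWord {l : List Bool} (h : isWeightedWord l) :
    ∃ x a b c d y, (c = 1 ∨ d ≤ 1) ∧ l = blockWord x a b c d y := by
  fun_induction isWeightedWord l with
  | case1 => exact ⟨0, 0, 0, 0, 0, 0, by simp, rfl⟩
  | case2 l ih =>
    obtain ⟨x, a, b, c, d, y, hd, rfl⟩ := ih h
    exact ⟨x + 1, a, b, c, d, y, hd, rfl⟩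
  | case3 l =>
    obtain ⟨a, b, c, d, y, hd, rfl⟩ := eq_of_isTailOfZeros h
    exact ⟨0, a + 1, b, c, d, y, hd, rfl⟩

/-- The characteristic word of a coalition. -/
def wordOf (M : Finset (Fin n)) : List Bool := List.ofFn fun i => decide (i ∈ M)

theorem exists_strictMono_of_sublist {M : Finset (Fin n)} {l : List Bool} (h : List.Sublist l (wordOf M)) :
    ∃ f : Fin l.length → Fin n, StrictMono f ∧ ∀ k, (f k ∈ M ↔ l.get k = true) := by
  obtain ⟨f, hf⟩ := List.sublist_iff_exists_fin_orderEmbedding_get_eq.1 h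
  refine ⟨fun k => (f k).cast (by simp [wordOf]), fun i j hij => ?_, fun k => ?_⟩
  · exact f.strictMono hij
  · rw [hf]
    simp only [wordOf, List.get_ofFn, decide_eq_true_eq]

theorem isWeighted_shiftGame_iff (M : {M : Finset (Fin n) // M.Nonempty}) :
    (shiftGame M).IsWeighted ↔ isWeightedWord (wordOf M.1) := by
  constructor
  · intro hw
    by_contra h
    rcases sublist_of_not_isWeightedWord h with h | h
    · obtain ⟨f, hmono, hf⟩ := exists_strictMono_of_sublist h
      have hlt : ∀ i j : Fin 6, i < j → f i < f j := fun i j hij => hmono hij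
      exact not_isWeighted_shiftGame (z₁ := f (0 : Fin 6)) (o₁ := f (1 : Fin 6))
        (z₂ := f (2 : Fin 6)) (z₃ := f (3 : Fin 6)) (o₂ := f (4 : Fin 6)) (o₃ := f (5 : Fin 6))
        (by simp [hf]) (by simp [hf]) (by simp [hf]) (by simp [hf]) (by simp [hf]) (by simp [hf])
        (hlt _ _ (by decide)) (hlt _ _ (by decide)) (hlt _ _ (by decide)) (hlt _ _ (by decide))
        (hlt _ _ (by decide)) (hlt _ _ (by decide)) hw
    · obtain ⟨f, hmono, hf⟩ := exists_strictMono_of_sublist h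
      have hlt : ∀ i j : Fin 6, i < j → f i < f j := fun i j hij => hmono hij
      exact not_isWeighted_shiftGame (z₁ := f (0 : Fin 6)) (o₁ := f (1 : Fin 6))
        (z₂ := f (2 : Fin 6)) (o₂ := f (3 : Fin 6)) (z₃ := f (4 : Fin 6)) (o₃ := f (5 : Fin 6))
        (by simp [hf]) (by simp [hf]) (by simp [hf]) (by simp [hf]) (by simp [hf]) (by simp [hf])
        (hlt _ _ (by decide)) (hlt _ _ (by decide)) (hlt _ _ (by decide)) (hlt _ _ (by decide))
        (hlt _ _ (by decide)) (hlt _ _ (by decide)) hw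
  · intro h
    obtain ⟨x, a, b, c, d, y, hcd, hw⟩ := eq_of_isWeightedWord h
    have hlen : n = x + a + b + c + d + y := by
      have := congrArg List.length hw
      simp only [wordOf, List.length_ofFn, blockWord, List.length_append,
        List.length_replicate] at this
      omega
    refine isWeighted_shiftGame M x a b c d (by omega) hcd fun i => ?_
    have h1 : (wordOf M.1)[i.val]? = some (decide (i ∈ M.1)) := by
      simp [wordOf]
    have hi := i.2
    rw [hw] at h1
    simp only [blockWord, List.getElem?_append, List.getElem?_replicate,
      List.length_replicate] at h1
    by_cases hm : i ∈ M.1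
    · simp only [hm, decide_true] at h1
      split_ifs at h1 <;> simp at h1 ⊢ <;> first | exact hm | (simp only [hm, true_iff]; omega)
    · simp only [hm, decide_false] at h1
      split_ifs at h1 <;> simp at h1 ⊢ <;> simp only [hm, false_iff] <;> omega

/-! ### Counting -/

/-- The number of words of length `n` with the property `P`. -/
def countWords (P : List Bool → Bool) (n : ℕ) : ℕ :=
  (Finset.univ.filter fun f : Fin n → Bool => P (List.ofFn f)).card

theorem countWords_zero (P : List Bool → Bool) : countWords P 0 = if P [] then 1 else 0 := by
  unfold countWords
  rw [Finset.card_filter]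
  simp

theorem countWords_succ (P : List Bool → Bool) (n : ℕ) : countWords P (n + 1)
    = countWords (fun l => P (true :: l)) n + countWords (fun l => P (false :: l)) n := by
  unfold countWords
  simp only [Finset.card_filter]
  rw [← (Fin.consEquiv fun _ : Fin (n + 1) => Bool).sum_comp, Fintype.sum_prod_type,
    Fintype.sum_bool]
  simp [Fin.consEquiv, List.ofFn_succ]

theorem countWords_isZeros (n : ℕ) : countWords isZeros n = 1 := by
  induction n with
  | zero => simp [countWords_zero, isZeros]
  | succ n ih =>
    rw [countWords_succ]
    simp only [isZeros]
    rw [ih]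
    simp [countWords]

theorem countWords_isOnesZeros (n : ℕ) : countWords isOnesZeros n = n + 1 := by
  induction n with
  | zero => simp [countWords_zero, isOnesZeros]
  | succ n ih =>
    rw [countWords_succ]
    simp only [isOnesZeros]
    rw [ih, countWords_isZeros]

theorem countWords_hasAtMostOneOne (n : ℕ) : countWords hasAtMostOneOne n = n + 1 := by
  induction n with
  | zero => simp [countWords_zero, hasAtMostOneOne]
  | succ n ih =>
    rw [countWords_succ]
    simp only [hasAtMostOneOne]
    rw [ih, countWords_isZeros]
    omega

/-- From here on the closed forms fail for the empty word, hence the index `n + 1`. -/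
theorem countWords_isTail (n : ℕ) : countWords isTail (n + 1) = 2 * (n + 1) := by
  rw [countWords_succ]
  simp only [isTail]
  rw [countWords_isOnesZeros, countWords_hasAtMostOneOne]
  omega

theorem countWords_isTailOfOnes (n : ℕ) :
    countWords isTailOfOnes (n + 1) = n * (n + 1) + 2 := by
  induction n with
  | zero => rw [countWords_succ]; simp [countWords_zero, isTailOfOnes, isTail]
  | succ n ih =>
    rw [countWords_succ]
    simp only [isTailOfOnes]
    rw [ih, countWords_isTail]
    ring

theorem countWords_isTailOfZeros (n : ℕ) :
    (countWords isTailOfZeros (n + 1) : ℚ) = ((n : ℚ) - 1) * n * (n + 1) / 3 + 2 * n + 2 := by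
  induction n with
  | zero => rw [countWords_succ]; simp [countWords_zero, isTailOfZeros, isTailOfOnes]
  | succ n ih =>
    rw [countWords_succ]
    simp only [isTailOfZeros]
    push_cast
    rw [ih, countWords_isTailOfOnes]
    push_cast
    ring

theorem countWords_isWeightedWord (n : ℕ) :
    (countWords isWeightedWord (n + 1) : ℚ)
      = (((n : ℚ) + 1) ^ 4 - 6 * ((n : ℚ) + 1) ^ 3 + 23 * ((n : ℚ) + 1) ^ 2
        - 18 * ((n : ℚ) + 1) + 12) / 12 + 1 := by
  induction n with
  | zero =>
    rw [countWords_succ]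
    norm_num [countWords_zero, isWeightedWord, isTailOfZeros]
  | succ n ih =>
    rw [countWords_succ]
    simp only [isWeightedWord]
    push_cast
    rw [ih, countWords_isTailOfZeros]
    ring

theorem isWeightedWord_wordOf_empty (n : ℕ) : isWeightedWord (wordOf (∅ : Finset (Fin n))) := by
  by_contra h
  rcases sublist_of_not_isWeightedWord h with h | h
  all_goals
    have := h.subset (by simp : true ∈ _)
    simp [wordOf] at this

/-- The extra `1` is the word `0^n`, which is accepted but generates no game. -/
theorem numWeighted_one_add_one (n : ℕ) : numWeighted n 1 + 1 = countWords isWeightedWord n := by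
  have h1 : Subtype.val '' {M : {M : Finset (Fin n) // M.Nonempty} | (shiftGame M).IsWeighted}
      = {M : Finset (Fin n) | isWeightedWord (wordOf M)} \ {∅} := by
    ext M
    constructor
    · rintro ⟨M, hM, rfl⟩
      exact ⟨(isWeighted_shiftGame_iff M).1 hM, M.2.ne_empty⟩
    · rintro ⟨hM, hne⟩
      exact ⟨⟨M, Finset.nonempty_iff_ne_empty.2 hne⟩, (isWeighted_shiftGame_iff _).2 hM, rfl⟩
  have h2 : (fun (M : Finset (Fin n)) (i : Fin n) => decide (i ∈ M)) ''
      {M : Finset (Fin n) | isWeightedWord (wordOf M)}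
      = ↑(Finset.univ.filter fun f : Fin n → Bool => isWeightedWord (List.ofFn f)) := by
    ext f
    constructor
    · rintro ⟨M, hM, rfl⟩
      simpa [wordOf] using hM
    · intro hf
      refine ⟨Finset.univ.filter fun i => f i, ?_, by ext i; simp⟩
      simpa [wordOf] using hf
  rw [numWeighted_one, ← Set.ncard_image_of_injective _ Subtype.val_injective, h1,
    Set.ncard_sdiff_singleton_add_one (s := {M : Finset (Fin n) | isWeightedWord (wordOf M)})
      (isWeightedWord_wordOf_empty n) (Set.toFinite _),
    ← Set.ncard_image_of_injective _ (f := fun (M : Finset (Fin n)) (i : Fin n) => decide (i ∈ M)),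
    h2, Set.ncard_coe_finset]
  · rfl
  · intro M M' h
    ext i
    simpa using congrFun h i

end SimpleGame

theorem corollaryc (n : ℕ) :
    (n ≤ 5 → (SimpleGame.numWeighted n 1 : ℚ) = 2 ^ n - 1) ∧
    (6 ≤ n → (SimpleGame.numWeighted n 1 : ℚ) =
      ((n : ℚ) ^ 4 - 6 * (n : ℚ) ^ 3 + 23 * (n : ℚ) ^ 2 - 18 * (n : ℚ) + 12) / 12) := by
  have h : (SimpleGame.numWeighted n 1 : ℚ) + 1
      = SimpleGame.countWords SimpleGame.isWeightedWord n := by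
    exact_mod_cast SimpleGame.numWeighted_one_add_one n
  rcases n with _ | n
  -- For `n = 0` the polynomial would give `1`, but there is no game.
  · rw [SimpleGame.countWords_zero] at h
    simpa [SimpleGame.isWeightedWord] using h
  rw [SimpleGame.countWords_isWeightedWord] at h
  rw [← eq_sub_iff_add_eq, add_sub_cancel_right] at h
  refine ⟨fun hn => ?_, fun _ => by rw [h]; push_cast; rfl⟩
  rw [h]
  have : n ≤ 4 := by omega
  interval_cases n <;> norm_num
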